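/- Let $A \in \mathbb{R}^{n\times n}$ be Schur unstable, i.e. its (possibly complex) eigenvalue $\lambda_{\max}(A)$ of largest modulus satisfies $|\lambda_{\max}(A)| > 1$, and suppose that $A$ is diagonalizable (over $\mathbb{C}$) by the invertible eigenvector matrix $V \in \mathbb{C}^{n\times n}$. Let $S \subseteq \{e_1,\dots,e_n\}$ be a set of canonical unit vectors (the actuator locations), and let $B_S \in \mathbb{R}^{n\times |S|}$ be the matrix whose columns are the elements of $S$. Let $Q \in \mathbb{R}^{n\times n}$ be symmetric positive semidefinite such that $(A, Q^{1/2})$ is detectable, i.e. there is $L\in\mathbb{R}^{n\times n}$ such that all eigenvalues of $A - LQ^{1/2}$ have modulus less than $1$. Let $P \succeq 0$ be the positive semidefinite solution of the algebraic Riccati equation with input cost matrix $R_S = I$, $$P = Q + A^T P A - A^T P B_S\,(I + B_S^T P B_S)^{-1} B_S^T P A .$$ For $\eta > 1$ let $\bar n$ denote the number of eigenvalues of $A$, counted with multiplicity, of modulus at least $\eta$, and let $\operatorname{cond}(V) = \|V\|_2\,\|V^{-1}\|_2$ be the spectral condition number. Then for every $\eta \in (1, |\lambda_{\max}(A)|]$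 the largest eigenvalue $\lambda_{\max}(P)$ of $P$ satisfies $$\lambda_{\max}(P) \;\ge\; \operatorname{cond}^{-2}(V)\,\frac{\eta^2-1}{\eta^2}\,\eta^{2\left(\frac{\bar n}{|S|}-1\right)} .$$ -/

import Mathlib

open scoped MatrixOrder

noncomputable section

/-- A real square matrix, viewed as a complex one. -/
def complexify {n : ℕ} (A : Matrix (Fin n) (Fin n) ℝ) : Matrix (Fin n) (Fin n) ℂ :=
  A.map (algebraMap ℝ ℂ)

/-- All complex eigenvalues of `A` have modulus `< 1`. -/
def IsSchurStable {n : ℕ} (A : Matrix (Fin n) (Fin n) ℝ) : Prop :=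
  spectralRadius ℂ (complexify A) < 1

/-- The complex eigenvalue of largest modulus has modulus `> 1`. -/
def IsSchurUnstable {n : ℕ} (A : Matrix (Fin n) (Fin n) ℝ) : Prop :=
  1 < spectralRadius ℂ (complexify A)

/-- The pair `(A, C)` is detectable: some output injection `L` makes `A - L C` Schur stable. -/
def IsDetectable {n p : ℕ} (A : Matrix (Fin n) (Fin n) ℝ) (C : Matrix (Fin p) (Fin n) ℝ) : Prop :=
  ∃ L : Matrix (Fin n) (Fin p) ℝ, IsSchurStable (A - L * C)

/-- `V` is an eigenvector matrix that diagonalizes `A` over `ℂ`: it is invertible and each of its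
columns is an eigenvector of `A`. -/
def IsEigenvectorMatrix {n : ℕ} (A : Matrix (Fin n) (Fin n) ℝ)
    (V : Matrix (Fin n) (Fin n) ℂ) : Prop :=
  IsUnit V ∧ ∃ d : Fin n → ℂ, complexify A * V = V * Matrix.diagonal d

/-- The spectral condition number `‖V‖₂ ‖V⁻¹‖₂`, that is `σ_max(V) / σ_min(V)`, of an invertible
matrix. -/
def condNumber {n : ℕ} (V : Matrix (Fin n) (Fin n) ℂ) : ℝ :=
  ‖Matrix.toEuclideanCLM (n := Fin n) (𝕜 := ℂ) V‖ *
    ‖Matrix.toEuclideanCLM (n := Fin n) (𝕜 := ℂ) V⁻¹‖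

open Classical in
/-- The number of complex eigenvalues of `A`, counted with algebraic multiplicity, of modulus at
least `η`. -/
def numEigenvaluesGE {n : ℕ} (A : Matrix (Fin n) (Fin n) ℝ) (η : ℝ) : ℕ :=
  (complexify A).charpoly.roots.countP (fun z => η ≤ ‖z‖)

/-- The largest eigenvalue of a symmetric matrix `P`. -/
def lambdaMax {n : ℕ} (P : Matrix (Fin n) (Fin n) ℝ) : ℝ :=
  sSup (spectrum ℝ P)

/-- The input matrix `B_S` whose columns are the canonical unit vectors `e_i`, `i ∈ S`. -/
def inputMatrix {n : ℕ} (S : Finset (Fin n)) : Matrix (Fin n) S ℝ :=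
  Matrix.of fun i s => if i = (s : Fin n) then 1 else 0

/-- `P` solves the discrete-time algebraic Riccati equation
`P = Q + Aᵀ P A - Aᵀ P B (R + Bᵀ P B)⁻¹ Bᵀ P A`. -/
def SolvesRiccati {n : ℕ} {m : Type*} [Fintype m] [DecidableEq m]
    (A : Matrix (Fin n) (Fin n) ℝ) (B : Matrix (Fin n) m ℝ) (Q : Matrix (Fin n) (Fin n) ℝ)
    (R : Matrix m m ℝ) (P : Matrix (Fin n) (Fin n) ℝ) : Prop :=
  P = Q + A.transpose * P * A
    - A.transpose * P * B * (R + B.transpose * P * B)⁻¹ * B.transpose * P * A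

end

section

open Matrix Filter Topology

/-! Completing squares gives a feedback `K` with `P = Q + MᵀPM + KᵀK`, `M = A - BK`, and
detectability makes `M` stable. So the input energy spent from `x₀` is at most `x₀*Px₀`. If `T|S|`
is less than the number of modes with `|d i| ≥ η`, some combination `c` of them is blind to the
first `T` inputs. Start at `V c̄` and pair the state with the weights `c i * (d i)⁻¹ ^ t`: only
inputs change this pairing, so it equals `‖c‖²` up to time `T`, yet it must tend to `0`. Later
inputs act with weights at most `η⁻¹ ^ (t + 1)`, so Cauchy–Schwarz forces their energy to be of
order `η ^ (2 * T)` (`energy_bound_of_stabilizing`). The theorem takes the largest such `T`. -/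

/-! ### Gram factors, Euclidean norms and pairings. -/

theorem Matrix.PosSemidef.sqrt_transpose_mul_sqrt {n : Type*} [Fintype n] [DecidableEq n]
    {P : Matrix n n ℝ} (hP : P.PosSemidef) : (CFC.sqrt P)ᵀ * CFC.sqrt P = P := by
  have h1 : (CFC.sqrt P)ᵀ = CFC.sqrt P := by
    simpa using (Matrix.nonneg_iff_posSemidef.mp (CFC.sqrt_nonneg P)).1.eq
  rw [h1, CFC.sqrt_mul_sqrt_self P hP.nonneg]

open scoped Matrix.Norms.L2Operator

theorem Matrix.norm_toLp_mulVec_le {m n : Type*} [Fintype m] [Fintype n] [DecidableEq n]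
    (M : Matrix m n ℂ) (x : n → ℂ) :
    ‖WithLp.toLp 2 (M *ᵥ x)‖ ≤ ‖M‖ * ‖WithLp.toLp 2 x‖ :=
  M.l2_opNorm_mulVec (WithLp.toLp 2 x)

theorem norm_dotProduct_le {n : Type*} [Fintype n] (x y : n → ℂ) :
    ‖x ⬝ᵥ y‖ ≤ ‖WithLp.toLp 2 x‖ * ‖WithLp.toLp 2 y‖ := by
  have h := norm_inner_le_norm (𝕜 := ℂ) (WithLp.toLp 2 (star x)) (WithLp.toLp 2 y)
  rw [EuclideanSpace.inner_eq_star_dotProduct] at h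
  have h2 : ‖WithLp.toLp 2 (star x)‖ = ‖WithLp.toLp 2 x‖ := by
    simp [EuclideanSpace.norm_eq]
  rw [h2] at h
  simpa [dotProduct_comm] using h

theorem dotProduct_star_eq_norm_sq {n : Type*} [Fintype n] (x : n → ℂ) :
    x ⬝ᵥ star x = ((‖WithLp.toLp 2 x‖ ^ 2 : ℝ) : ℂ) := by
  rw [EuclideanSpace.norm_sq_eq]
  simp [dotProduct, Complex.mul_conj, Complex.normSq_eq_norm_sq]

/-! ### Lower bound on the energy of a stabilizing feedback. -/

/-- If there are more modes than control actions during `T` steps, some nonzero combination of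
the modes is unaffected by these actions. -/
theorem exists_uncontrolled_combination {ι m : Type*} [Fintype ι] [Fintype m] [DecidableEq ι]
    (J : Finset ι) (d : ι → ℂ) (M : Matrix ι m ℂ) (T : ℕ) (hT : T * Fintype.card m < J.card) :
    ∃ c : ι → ℂ, c ≠ 0 ∧ (∀ i, i ∉ J → c i = 0) ∧
      ∀ t < T, (fun i => c i * (d i)⁻¹ ^ (t + 1)) ᵥ* M = 0 := by
  let F : Matrix (Fin T × m) J ℂ := Matrix.of fun p i => (d i)⁻¹ ^ ((p.1 : ℕ) + 1) * M i p.2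
  have hker : LinearMap.ker F.mulVecLin ≠ ⊥ := by
    apply LinearMap.ker_ne_bot_of_finrank_lt
    simpa using hT
  obtain ⟨c, hc, hc0⟩ := Submodule.exists_mem_ne_zero_of_ne_bot hker
  refine ⟨fun i => if h : i ∈ J then c ⟨i, h⟩ else 0, ?_, ?_, ?_⟩
  · intro h
    apply hc0
    ext i
    simpa using congrFun h i
  · intro i hi
    simp [hi]
  · intro t ht
    ext s
    have h := congrFun (LinearMap.mem_ker.mp hc) (⟨t, ht⟩, s)
    simp only [Matrix.mulVecLin_apply, Matrix.mulVec, dotProduct, F, Matrix.of_apply,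
      Pi.zero_apply] at h
    simp only [Matrix.vecMul, dotProduct, Pi.zero_apply]
    refine Eq.trans ?_ h
    rw [← Finset.sum_subset (Finset.subset_univ J), ← Finset.sum_coe_sort J]
    · refine Finset.sum_congr rfl fun i _ => ?_
      simp
      ring
    · intro i _ hi
      simp [hi]

theorem sum_inv_pow_sq_le {η : ℝ} (hη : 1 < η) (T N : ℕ) :
    ∑ i ∈ Finset.range N, (η⁻¹ ^ (T + i + 1)) ^ 2 ≤ η⁻¹ ^ (2 * T) / (η ^ 2 - 1) := by
  have hpos : 0 < η ^ 2 - 1 := by nlinarith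
  have h : ∑ i ∈ Finset.range N, (η⁻¹ ^ (T + i + 1)) ^ 2 =
      (η⁻¹ ^ (2 * T) - η⁻¹ ^ (2 * (T + N))) / (η ^ 2 - 1) := by
    induction N with
    | zero => simp
    | succ N ih =>
      have h0 : η ≠ 0 := by positivity
      rw [Finset.sum_range_succ, ih, eq_div_iff hpos.ne', add_mul, div_mul_cancel₀ _ hpos.ne']
      have : η⁻¹ ^ 2 * η ^ 2 = 1 := by field_simp
      linear_combination (η⁻¹ ^ (2 * (T + N))) * this
  rw [h]
  have : 0 ≤ η⁻¹ ^ (2 * (T + N)) := by positivity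
  gcongr
  linarith

/-- A stabilizing feedback `K` whose input energy is bounded by `r ‖x‖²` has to pay for the unstable
modes of `A` that are unaffected by the inputs of `T` steps. -/
theorem energy_bound_of_stabilizing {n m : Type*} [Fintype n] [Fintype m] [DecidableEq n]
    [DecidableEq m] (A V W : Matrix n n ℂ) (B : Matrix n m ℂ) (K : Matrix m n ℂ) (d : n → ℂ)
    (hWV : W * V = 1) (hWA : W * A = diagonal d * W) (hB : ‖B‖ ≤ 1)
    (hstab : Tendsto (fun k : ℕ => (A - B * K) ^ k) atTop (𝓝 0))
    (E : (n → ℂ) → ℝ) (hE0 : ∀ x, 0 ≤ E x) (r : ℝ) (hEr : ∀ x, E x ≤ r * ‖WithLp.toLp 2 x‖ ^ 2)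
    (hE : ∀ x, E ((A - B * K) *ᵥ x) + ‖WithLp.toLp 2 (K *ᵥ x)‖ ^ 2 ≤ E x)
    (η : ℝ) (hη : 1 < η) (J : Finset n) (hJ : ∀ i ∈ J, η ≤ ‖d i‖)
    (T : ℕ) (hT : T * Fintype.card m < J.card) :
    (η ^ 2 - 1) * η ^ (2 * T) ≤ r * (‖V‖ * ‖W‖) ^ 2 := by
  obtain ⟨c, hc0, hcJ, hc⟩ := exists_uncontrolled_combination J d (W * B) T hT
  have hη0 : 0 < η := by linarith
  -- `x` is the closed-loop trajectory; `w` runs the adjoint dynamics, `w (t + 1) W A = w t W`. Off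
  -- `J`, where `d i` may vanish, `c i = 0`.
  set x : ℕ → n → ℂ := fun k => (A - B * K) ^ k *ᵥ (V *ᵥ star c) with hx
  set w : ℕ → n → ℂ := fun t i => c i * (d i)⁻¹ ^ t with hw
  set γ := ‖WithLp.toLp 2 c‖ with hγ
  have hγ0 : 0 < γ := by
    rw [hγ, norm_pos_iff]
    intro h
    exact hc0 (by simpa using congrArg WithLp.ofLp h)
  have hxs : ∀ k, x (k + 1) = (A - B * K) *ᵥ x k := by
    intro k
    simp [hx, pow_succ', Matrix.mulVec_mulVec, Matrix.mul_assoc]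
  have hwnorm : ∀ t, ‖WithLp.toLp 2 (w t)‖ ≤ η⁻¹ ^ t * γ := by
    intro t
    rw [hγ, EuclideanSpace.norm_eq, EuclideanSpace.norm_eq]
    apply Real.sqrt_le_iff.mpr
    refine ⟨by positivity, ?_⟩
    rw [mul_pow, Real.sq_sqrt (by positivity), Finset.mul_sum]
    refine Finset.sum_le_sum fun i _ => ?_
    simp only [hw]
    by_cases hi : i ∈ J
    · rw [norm_mul, mul_pow, norm_pow, norm_inv, mul_comm]
      have := hJ i hi
      gcongr
    · simp [hcJ i hi]
  have hwA : ∀ t y, w (t + 1) ⬝ᵥ (W *ᵥ (A *ᵥ y)) = w t ⬝ᵥ (W *ᵥ y) := by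
    intro t y
    rw [Matrix.mulVec_mulVec, hWA, ← Matrix.mulVec_mulVec]
    simp only [dotProduct, Matrix.mulVec_diagonal, hw]
    refine Finset.sum_congr rfl fun i _ => ?_
    by_cases hi : i ∈ J
    · have hd : d i ≠ 0 := norm_pos_iff.mp (hη0.trans_le (hJ i hi))
      have h1 : (d i)⁻¹ ^ (t + 1) * d i = (d i)⁻¹ ^ t := by
        rw [pow_succ, mul_assoc, inv_mul_cancel₀ hd, mul_one]
      linear_combination (c i * (W *ᵥ y) i) * h1
    · simp [hcJ i hi]
  have hstep : ∀ t, w t ⬝ᵥ (W *ᵥ x t) = w (t + 1) ⬝ᵥ (W *ᵥ x (t + 1)) +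
      w (t + 1) ᵥ* (W * B) ⬝ᵥ (K *ᵥ x t) := by
    intro t
    rw [hxs, Matrix.sub_mulVec, Matrix.mulVec_sub, dotProduct_sub, hwA, ← Matrix.dotProduct_mulVec]
    simp [Matrix.mulVec_mulVec, Matrix.mul_assoc]
  have hinit : ∀ t ≤ T, w t ⬝ᵥ (W *ᵥ x t) = ((γ ^ 2 : ℝ) : ℂ) := by
    intro t
    induction t with
    | zero =>
      intro _
      simpa [hx, hw, Matrix.mulVec_mulVec, hWV, hγ] using dotProduct_star_eq_norm_sq c
    | succ t ih =>
      intro ht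
      rw [← ih (by omega), hstep t, hc t (by omega)]
      simp
  have hu : ∀ t, ‖w (t + 1) ᵥ* (W * B) ⬝ᵥ (K *ᵥ x t)‖ ≤
      γ * ‖W‖ * (η⁻¹ ^ (t + 1) * ‖WithLp.toLp 2 (K *ᵥ x t)‖) := by
    intro t
    rw [← Matrix.dotProduct_mulVec]
    calc _ ≤ ‖WithLp.toLp 2 (w (t + 1))‖ * ‖WithLp.toLp 2 ((W * B) *ᵥ (K *ᵥ x t))‖ :=
          norm_dotProduct_le _ _
      _ ≤ (η⁻¹ ^ (t + 1) * γ) * ((‖W‖ * 1) * ‖WithLp.toLp 2 (K *ᵥ x t)‖) := by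
          gcongr
          · exact hwnorm _
          · refine (Matrix.norm_toLp_mulVec_le _ _).trans ?_
            gcongr
            refine (Matrix.l2_opNorm_mul _ _).trans ?_
            gcongr
      _ = _ := by ring
  have htel : ∀ N, γ ^ 2 ≤ ‖w (T + N) ⬝ᵥ (W *ᵥ x (T + N))‖ + γ * ‖W‖ *
      ∑ i ∈ Finset.range N, η⁻¹ ^ (T + i + 1) * ‖WithLp.toLp 2 (K *ᵥ x (T + i))‖ := by
    intro N
    induction N with
    | zero =>
      simp only [add_zero, hinit T le_rfl, Complex.norm_real, Finset.range_zero, Finset.sum_empty,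
        mul_zero]
      exact le_abs_self _
    | succ N ih =>
      rw [Finset.sum_range_succ, mul_add]
      rw [hstep] at ih
      have h1 := norm_add_le (w (T + N + 1) ⬝ᵥ (W *ᵥ x (T + N + 1)))
        (w (T + N + 1) ᵥ* (W * B) ⬝ᵥ (K *ᵥ x (T + N)))
      have h2 := hu (T + N)
      rw [← add_assoc, ← add_assoc T N 1]
      linarith
  have hEx : ∀ N, E (x N) + ∑ i ∈ Finset.range N, ‖WithLp.toLp 2 (K *ᵥ x i)‖ ^ 2 ≤ E (x 0) := by
    intro N
    induction N with
    | zero => simp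
    | succ N ih =>
      have := hE (x N)
      rw [Finset.sum_range_succ, hxs]
      linarith
  have hr0 : E (x 0) ≤ r * (‖V‖ * γ) ^ 2 := by
    have hs : ‖WithLp.toLp 2 (star c)‖ = γ := by simp [hγ, EuclideanSpace.norm_eq]
    -- Nonnegativity of `r` follows by testing `E` on the nonzero vector `star c`.
    have hrr : 0 ≤ r := by
      have h1 := (hE0 (star c)).trans (hEr _)
      rw [hs] at h1
      exact nonneg_of_mul_nonneg_left h1 (by positivity)
    refine (hEr _).trans ?_
    gcongr
    simp only [hx, pow_zero, Matrix.one_mulVec]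
    rw [← hs]
    exact Matrix.norm_toLp_mulVec_le _ _
  have hsum : ∀ N, ∑ i ∈ Finset.range N, ‖WithLp.toLp 2 (K *ᵥ x (T + i))‖ ^ 2 ≤
      r * (‖V‖ * γ) ^ 2 := by
    intro N
    have h1 := hEx (T + N)
    rw [Finset.sum_range_add] at h1
    have h2 : 0 ≤ ∑ i ∈ Finset.range T, ‖WithLp.toLp 2 (K *ᵥ x i)‖ ^ 2 := by positivity
    have := hE0 (x (T + N))
    linarith
  have hpos : 0 < η ^ 2 - 1 := by nlinarith
  set G := η⁻¹ ^ (2 * T) / (η ^ 2 - 1) with hG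
  have hfin : ∀ N, γ ^ 2 ≤ γ * ‖W‖ * ‖WithLp.toLp 2 (x (T + N))‖ +
      γ * ‖W‖ * (√G * √(r * (‖V‖ * γ) ^ 2)) := by
    intro N
    refine (htel N).trans ?_
    gcongr
    · calc _ ≤ ‖WithLp.toLp 2 (w (T + N))‖ * ‖WithLp.toLp 2 (W *ᵥ x (T + N))‖ :=
            norm_dotProduct_le _ _
        _ ≤ (1 * γ) * (‖W‖ * ‖WithLp.toLp 2 (x (T + N))‖) := by
            gcongr
            · refine (hwnorm _).trans ?_
              gcongr
              exact pow_le_one₀ (by positivity) (inv_le_one_of_one_le₀ hη.le)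
            · exact Matrix.norm_toLp_mulVec_le _ _
        _ = _ := by ring
    · refine (Real.sum_mul_le_sqrt_mul_sqrt _ _ _).trans ?_
      gcongr
      · exact sum_inv_pow_sq_le hη T N
      · exact hsum N
  have hxlim : Tendsto (fun N => ‖WithLp.toLp 2 (x (T + N))‖) atTop (𝓝 0) := by
    have h1 : Tendsto (fun N => ‖(A - B * K) ^ (T + N)‖ * ‖WithLp.toLp 2 (V *ᵥ star c)‖) atTop
        (𝓝 0) := by
      have h2 := (hstab.comp (tendsto_add_atTop_nat T)).norm.mul_const
        ‖WithLp.toLp 2 (V *ᵥ star c)‖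
      simpa [Function.comp_def, add_comm] using h2
    exact squeeze_zero (fun _ => norm_nonneg _) (fun N => Matrix.norm_toLp_mulVec_le _ _) h1
  -- As `N → ∞` stability removes the terminal pairing, leaving only the input term.
  have hlim := ge_of_tendsto' ((hxlim.const_mul (γ * ‖W‖)).add_const
    (γ * ‖W‖ * (√G * √(r * (‖V‖ * γ) ^ 2)))) hfin
  have hrg : 0 ≤ r * (‖V‖ * γ) ^ 2 := (hE0 _).trans hr0
  rw [mul_zero, zero_add] at hlim
  have hsq := pow_le_pow_left₀ (by positivity) hlim 2
  rw [mul_pow, mul_pow (√G), Real.sq_sqrt hrg, Real.sq_sqrt (by positivity)] at hsq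
  have hsq' : γ ^ 4 * 1 ≤ γ ^ 4 * (G * (r * (‖V‖ * ‖W‖) ^ 2)) := by
    nlinarith [hsq]
  have h1 := le_of_mul_le_mul_left hsq' (by positivity)
  rw [hG, inv_pow] at h1
  have h2 : (η ^ (2 * T))⁻¹ / (η ^ 2 - 1) * (r * (‖V‖ * ‖W‖) ^ 2) =
      (r * (‖V‖ * ‖W‖) ^ 2) / ((η ^ 2 - 1) * η ^ (2 * T)) := by
    field_simp
  rw [h2, le_div_iff₀ (by positivity), one_mul] at h1
  exact h1

/-! ### Spectral radius and stability of the closed loop. -/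

/-- Gelfand's formula: eventually `‖a ^ k‖ ≤ q ^ k` for some `q < 1`. -/
theorem tendsto_pow_zero_of_spectralRadius_lt_one {R : Type*} [NormedRing R] [NormedAlgebra ℂ R]
    [CompleteSpace R] {a : R} (h : spectralRadius ℂ a < 1) :
    Tendsto (fun k : ℕ => a ^ k) atTop (𝓝 0) := by
  obtain ⟨q, hq, hq1⟩ := ENNReal.lt_iff_exists_nnreal_btwn.mp h
  have hq1' : q < 1 := by exact_mod_cast hq1
  have hev := (spectrum.pow_nnnorm_pow_one_div_tendsto_nhds_spectralRadius a).eventually_lt_const hq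
  refine squeeze_zero_norm' ?_
    (tendsto_pow_atTop_nhds_zero_of_lt_one q.coe_nonneg (by exact_mod_cast hq1'))
  filter_upwards [hev, eventually_gt_atTop 0] with k hk hk0
  rw [one_div] at hk
  have h1 := (ENNReal.rpow_inv_le_iff (by exact_mod_cast hk0)).mp hk.le
  rw [ENNReal.rpow_natCast] at h1
  exact_mod_cast h1

theorem Matrix.tendsto_pow_zero_of_spectralRadius_lt_one {n : Type*} [Fintype n] [DecidableEq n]
    {M : Matrix n n ℂ} (h : spectralRadius ℂ M < 1) :
    Tendsto (fun k : ℕ => M ^ k) atTop (𝓝 0) :=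
  _root_.tendsto_pow_zero_of_spectralRadius_lt_one h

theorem Matrix.spectralRadius_lt_one_of_forall_eigenvector {n : Type*} [Fintype n] [DecidableEq n]
    {M : Matrix n n ℂ} (h : ∀ (μ : ℂ) (v : n → ℂ), v ≠ 0 → M *ᵥ v = μ • v → ‖μ‖ < 1) :
    spectralRadius ℂ M < 1 := by
  rcases isEmpty_or_nonempty n with hn | hn
  · simp [spectralRadius, spectrum.of_subsingleton]
  refine spectrum.spectralRadius_lt_of_forall_lt_of_nonempty (spectrum.nonempty M) (r := 1) ?_
  intro μ hμ
  rw [← Matrix.spectrum_toLin', ← Module.End.hasEigenvalue_iff_mem_spectrum] at hμ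
  obtain ⟨v, hv⟩ := hμ.exists_hasEigenvector
  exact_mod_cast h μ v hv.2 (by simpa using hv.apply_eq_smul)

theorem Matrix.norm_lt_one_of_spectralRadius_lt_one {n : Type*} [Fintype n] [DecidableEq n]
    {M : Matrix n n ℂ} (h : spectralRadius ℂ M < 1) {μ : ℂ} {v : n → ℂ} (hv : v ≠ 0)
    (hμ : M *ᵥ v = μ • v) : ‖μ‖ < 1 := by
  have hmem : μ ∈ spectrum ℂ M := by
    rw [← Matrix.spectrum_toLin', ← Module.End.hasEigenvalue_iff_mem_spectrum]
    exact Module.End.hasEigenvalue_of_hasEigenvector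
      (Module.End.hasEigenvector_iff.mpr ⟨Module.End.mem_eigenspace_iff.mpr (by simpa using hμ), hv⟩)
  have h1 : (‖μ‖₊ : ENNReal) ≤ spectralRadius ℂ M :=
    le_iSup₂ (f := fun (k : ℂ) (_ : k ∈ spectrum ℂ M) => (‖k‖₊ : ENNReal)) μ hmem
  exact_mod_cast h1.trans_lt h

/-- Detectability turns the energy identity of a feedback into stability of the closed loop. -/
theorem spectralRadius_closedLoop_lt_one {n m p : Type*} [Fintype n] [Fintype m] [Fintype p]
    [DecidableEq n] (A R : Matrix n n ℂ) (B : Matrix n m ℂ) (K : Matrix m n ℂ) (C : Matrix p n ℂ)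
    (L : Matrix n p ℂ) (hL : spectralRadius ℂ (A - L * C) < 1)
    (hE : ∀ x, ‖WithLp.toLp 2 (R *ᵥ x)‖ ^ 2 = ‖WithLp.toLp 2 (C *ᵥ x)‖ ^ 2 +
      ‖WithLp.toLp 2 (R *ᵥ ((A - B * K) *ᵥ x))‖ ^ 2 + ‖WithLp.toLp 2 (K *ᵥ x)‖ ^ 2) :
    spectralRadius ℂ (A - B * K) < 1 := by
  refine Matrix.spectralRadius_lt_one_of_forall_eigenvector fun μ v hv hμ => ?_
  by_contra! hμ1
  have h := hE v
  rw [hμ, Matrix.mulVec_smul, WithLp.toLp_smul, norm_smul, mul_pow] at h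
  have h1 : 1 ≤ ‖μ‖ ^ 2 := one_le_pow₀ hμ1
  have h2 := mul_le_mul_of_nonneg_right h1 (sq_nonneg ‖WithLp.toLp 2 (R *ᵥ v)‖)
  -- With `‖μ‖ ≥ 1` the storage term cannot decrease along `v`, so both costs vanish and `v` is also
  -- an eigenvector of `A - L * C`.
  have hC : ‖WithLp.toLp 2 (C *ᵥ v)‖ ^ 2 = 0 := by
    nlinarith [sq_nonneg ‖WithLp.toLp 2 (C *ᵥ v)‖, sq_nonneg ‖WithLp.toLp 2 (K *ᵥ v)‖]
  have hK : ‖WithLp.toLp 2 (K *ᵥ v)‖ ^ 2 = 0 := by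
    nlinarith [sq_nonneg ‖WithLp.toLp 2 (C *ᵥ v)‖, sq_nonneg ‖WithLp.toLp 2 (K *ᵥ v)‖]
  have hC0 : C *ᵥ v = 0 := by simpa using hC
  have hK0 : K *ᵥ v = 0 := by simpa using hK
  have hAv : (A - L * C) *ᵥ v = μ • v := by
    rw [← hμ, Matrix.sub_mulVec, Matrix.sub_mulVec, ← Matrix.mulVec_mulVec, ← Matrix.mulVec_mulVec,
      hC0, hK0]
    simp
  exact absurd (Matrix.norm_lt_one_of_spectralRadius_lt_one hL hv hAv) (not_lt.mpr hμ1)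

/-! ### From the Riccati equation to complex energy estimates. -/

/-- Completion of squares in the Riccati equation. -/
theorem SolvesRiccati.eq_closedLoop {n : ℕ} {m : Type*} [Fintype m] [DecidableEq m]
    {A Q P : Matrix (Fin n) (Fin n) ℝ} {B : Matrix (Fin n) m ℝ} (hP : P.PosSemidef)
    (h : SolvesRiccati A B Q 1 P) :
    ∃ K : Matrix m (Fin n) ℝ, P = Q + (A - B * K)ᵀ * P * (A - B * K) + Kᵀ * K := by
  set G := 1 + Bᵀ * P * B with hG
  have hGpos : G.PosDef := by
    have h1 := hP.conjTranspose_mul_mul_same B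
    rw [Matrix.conjTranspose_eq_transpose_of_trivial] at h1
    exact Matrix.PosDef.one.add_posSemidef h1
  have hGu : IsUnit G.det := (Matrix.isUnit_iff_isUnit_det _).mp hGpos.isUnit
  refine ⟨G⁻¹ * Bᵀ * P * A, ?_⟩
  set K := G⁻¹ * Bᵀ * P * A with hK
  have hGK : G * K = Bᵀ * P * A := by
    rw [hK]
    simp only [← Matrix.mul_assoc, Matrix.mul_nonsing_inv _ hGu, Matrix.one_mul]
  -- The left side is `KᵀGK`; it cancels one of the two cross terms of the closed loop.
  have h1 : Kᵀ * K + Kᵀ * (Bᵀ * P * B) * K = Kᵀ * (Bᵀ * P * A) := by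
    rw [← hGK, hG]
    simp only [Matrix.add_mul, Matrix.mul_add, Matrix.one_mul, Matrix.mul_assoc]
  have h2 : P = Q + Aᵀ * P * A - Aᵀ * P * B * K := by
    have h3 : P = _ := h
    rw [← hG] at h3
    rw [hK]
    simpa only [Matrix.mul_assoc] using h3
  rw [Matrix.transpose_sub, Matrix.transpose_mul]
  conv_lhs => rw [h2]
  have h4 : (Aᵀ - Kᵀ * Bᵀ) * P * (A - B * K) = Aᵀ * P * A - Aᵀ * P * B * K - Kᵀ * (Bᵀ * P * A)
      + Kᵀ * (Bᵀ * P * B) * K := by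
    simp only [Matrix.sub_mul, Matrix.mul_sub, Matrix.mul_assoc]
    abel
  rw [h4, ← h1]
  abel

/-- A real matrix, not necessarily square, viewed as a complex one. -/
noncomputable abbrev Matrix.ofRealMap {m n : Type*} (M : Matrix m n ℝ) : Matrix m n ℂ :=
  M.map (algebraMap ℝ ℂ)

theorem Matrix.star_dotProduct_ofRealMap_gram {m n : Type*} [Fintype m] [Fintype n]
    (M : Matrix m n ℝ) (x : n → ℂ) :
    star x ⬝ᵥ ((Mᵀ * M).ofRealMap *ᵥ x) = ((‖WithLp.toLp 2 (M.ofRealMap *ᵥ x)‖ ^ 2 : ℝ) : ℂ) := by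
  have h : (Mᵀ * M).ofRealMap = M.ofRealMapᴴ * M.ofRealMap := by
    rw [Matrix.ofRealMap, Matrix.map_mul]
    congr 1
    ext i j
    simp
  rw [h, ← Matrix.mulVec_mulVec, Matrix.dotProduct_mulVec, ← Matrix.star_mulVec, dotProduct_comm]
  exact dotProduct_star_eq_norm_sq _

/-- Factoring `λI - P = MᵀM` over the reals carries the bound to complex vectors. -/
theorem norm_mulVec_sq_le_lambdaMax {n : ℕ} {m : Type*} [Fintype m]
    {P : Matrix (Fin n) (Fin n) ℝ} {R : Matrix m (Fin n) ℝ} (hP : P.PosSemidef) (hR : Rᵀ * R = P)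
    (x : Fin n → ℂ) :
    ‖WithLp.toLp 2 (R.ofRealMap *ᵥ x)‖ ^ 2 ≤ lambdaMax P * ‖WithLp.toLp 2 x‖ ^ 2 := by
  have h1 : P ≤ algebraMap ℝ _ (lambdaMax P) :=
    le_algebraMap_of_spectrum_le
      (fun y hy => le_csSup (Matrix.finite_real_spectrum (A := P)).bddAbove hy) hP.1
  obtain ⟨M, h2⟩ : ∃ M : Matrix (Fin n) (Fin n) ℝ, Mᵀ * M = algebraMap ℝ _ (lambdaMax P) - P :=
    ⟨_, (Matrix.le_iff.mp h1).sqrt_transpose_mul_sqrt⟩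
  have h3 := M.star_dotProduct_ofRealMap_gram x
  have h4 := R.star_dotProduct_ofRealMap_gram x
  rw [hR] at h4
  have h5 : (algebraMap ℝ (Matrix (Fin n) (Fin n) ℝ) (lambdaMax P) - P).ofRealMap =
      (lambdaMax P : ℂ) • 1 - P.ofRealMap := by
    ext i j
    by_cases hij : i = j <;> simp [Matrix.algebraMap_matrix_apply, hij]
  rw [h2, h5, Matrix.sub_mulVec, dotProduct_sub, h4, Matrix.smul_mulVec, Matrix.one_mulVec,
    dotProduct_smul, dotProduct_comm, dotProduct_star_eq_norm_sq, smul_eq_mul] at h3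
  have h6 : lambdaMax P * ‖WithLp.toLp 2 x‖ ^ 2 - ‖WithLp.toLp 2 (R.ofRealMap *ᵥ x)‖ ^ 2 =
      ‖WithLp.toLp 2 (M.ofRealMap *ᵥ x)‖ ^ 2 := by exact_mod_cast h3
  nlinarith [sq_nonneg ‖WithLp.toLp 2 (M.ofRealMap *ᵥ x)‖]

theorem norm_inputMatrix_le_one {n : ℕ} (S : Finset (Fin n)) :
    ‖(inputMatrix S).ofRealMap‖ ≤ 1 := by
  have h : (inputMatrix S).ofRealMapᴴ * (inputMatrix S).ofRealMap = 1 := by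
    ext s t
    simp [inputMatrix, Matrix.mul_apply, Matrix.one_apply, apply_ite (algebraMap ℝ ℂ), eq_comm (a := t)]
  have h1 := Matrix.l2_opNorm_conjTranspose_mul_self (inputMatrix S).ofRealMap
  rw [h] at h1
  have h2 : ‖(1 : Matrix S S ℂ)‖ ≤ 1 := by
    rw [← Matrix.diagonal_one, Matrix.l2_opNorm_diagonal]
    exact (pi_norm_le_iff_of_nonneg zero_le_one).mpr (by simp)
  nlinarith [norm_nonneg (inputMatrix S).ofRealMap]

/-! ### Counting eigenvalues and assembling the bound. -/

/-- The number of eigenvalues of a diagonalized matrix of modulus at least `η`. -/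
theorem numEigenvaluesGE_eq_card {n : ℕ} {A : Matrix (Fin n) (Fin n) ℝ}
    {V : Matrix (Fin n) (Fin n) ℂ} {d : Fin n → ℂ} (hV : IsUnit V)
    (h : complexify A * V = V * diagonal d) (η : ℝ) :
    numEigenvaluesGE A η = (Finset.univ.filter fun i => η ≤ ‖d i‖).card := by
  obtain ⟨U, rfl⟩ := hV
  have h1 : complexify A = U.val * diagonal d * U⁻¹.val := by
    rw [← h, Matrix.mul_assoc, Units.mul_inv, Matrix.mul_one]
  have h2 : (complexify A).charpoly.roots = Finset.univ.val.map d := by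
    rw [h1, Matrix.coe_units_inv, Matrix.charpoly_units_conj, Matrix.charpoly_diagonal, Polynomial.roots_prod _ _
      (Finset.prod_ne_zero_iff.mpr fun i _ => Polynomial.X_sub_C_ne_zero _)]
    simp [Multiset.bind_singleton]
  rw [numEigenvaluesGE, h2, Multiset.countP_map, Finset.card_def, Finset.filter_val]

theorem numEigenvaluesGE_pos {n : ℕ} {A : Matrix (Fin n) (Fin n) ℝ} {η : ℝ} (hη : 0 < η)
    (h : ENNReal.ofReal η ≤ spectralRadius ℂ (complexify A)) : 0 < numEigenvaluesGE A η := by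
  have hne : (spectrum ℂ (complexify A)).Nonempty := by
    by_contra hemp
    rw [Set.not_nonempty_iff_eq_empty] at hemp
    simp [spectralRadius, hemp] at h
    linarith
  obtain ⟨μ, hμ, hμr⟩ := spectrum.exists_nnnorm_eq_spectralRadius_of_nonempty hne
  rw [numEigenvaluesGE, Multiset.countP_pos]
  refine ⟨μ, ?_, ?_⟩
  · rw [Polynomial.mem_roots (Matrix.charpoly_monic _).ne_zero]
    exact Matrix.mem_spectrum_iff_isRoot_charpoly.mp hμ
  · rw [← hμr, ← enorm_eq_nnnorm, ← ofReal_norm, ENNReal.ofReal_le_ofReal_iff (norm_nonneg _)] at h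
    exact h

theorem norm_mulVec_sq_eq_of_gram {n m p q : Type*} [Fintype n] [Fintype m] [Fintype p] [Fintype q]
    {M P Q : Matrix n n ℝ} {R : Matrix p n ℝ} {C : Matrix q n ℝ} {K : Matrix m n ℝ}
    (hR : Rᵀ * R = P) (hC : Cᵀ * C = Q) (h : P = Q + Mᵀ * P * M + Kᵀ * K) (x : n → ℂ) :
    ‖WithLp.toLp 2 (R.ofRealMap *ᵥ x)‖ ^ 2 = ‖WithLp.toLp 2 (C.ofRealMap *ᵥ x)‖ ^ 2 +
      ‖WithLp.toLp 2 (R.ofRealMap *ᵥ (M.ofRealMap *ᵥ x))‖ ^ 2 +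
      ‖WithLp.toLp 2 (K.ofRealMap *ᵥ x)‖ ^ 2 := by
  have hM : Mᵀ * P * M = (R * M)ᵀ * (R * M) := by
    rw [← hR]
    simp only [Matrix.transpose_mul, Matrix.mul_assoc]
  have h1 := R.star_dotProduct_ofRealMap_gram x
  have h2 := C.star_dotProduct_ofRealMap_gram x
  have h3 := (R * M).star_dotProduct_ofRealMap_gram x
  have h4 := K.star_dotProduct_ofRealMap_gram x
  rw [hR] at h1
  rw [hC] at h2
  rw [← hM] at h3
  have h5 : (R * M).ofRealMap *ᵥ x = R.ofRealMap *ᵥ (M.ofRealMap *ᵥ x) := by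
    rw [Matrix.ofRealMap, Matrix.map_mul, Matrix.mulVec_mulVec]
  have h6 : P.ofRealMap = Q.ofRealMap + (Mᵀ * P * M).ofRealMap + (Kᵀ * K).ofRealMap := by
    conv_lhs => rw [h]
    rw [Matrix.ofRealMap, Matrix.map_add _ (map_add _), Matrix.map_add _ (map_add _)]
  rw [h6, Matrix.add_mulVec, Matrix.add_mulVec, dotProduct_add, dotProduct_add, h2, h3, h4, h5] at h1
  exact_mod_cast h1.symm

theorem complexify_sub_mul {n : ℕ} {m : Type*} [Fintype m] (A : Matrix (Fin n) (Fin n) ℝ)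
    (B : Matrix (Fin n) m ℝ) (K : Matrix m (Fin n) ℝ) :
    complexify (A - B * K) = complexify A - B.ofRealMap * K.ofRealMap := by
  rw [complexify, Matrix.map_sub _ (map_sub _), Matrix.map_mul, complexify]

/-- If fewer than `numEigenvaluesGE A η` scalar control actions take place during `T` steps, the
optimal cost is at least of order `η ^ (2 * T)`. -/
theorem le_lambdaMax_mul_condNumber_sq {n p : ℕ} {A P Q : Matrix (Fin n) (Fin n) ℝ}
    {V : Matrix (Fin n) (Fin n) ℂ} (hV : IsEigenvectorMatrix A V) {S : Finset (Fin n)} {η : ℝ}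
    (hη : 1 < η) {C : Matrix (Fin p) (Fin n) ℝ} (hC : Cᵀ * C = Q) (hdet : IsDetectable A C)
    (hP : P.PosSemidef) (hric : SolvesRiccati A (inputMatrix S) Q 1 P)
    {T : ℕ} (hT : T * S.card < numEigenvaluesGE A η) :
    (η ^ 2 - 1) * η ^ (2 * T) ≤ lambdaMax P * condNumber V ^ 2 := by
  obtain ⟨hVu, d, hd⟩ := hV
  obtain ⟨L, hL⟩ := hdet
  obtain ⟨K, hK⟩ := hric.eq_closedLoop hP
  obtain ⟨R, hR⟩ : ∃ R : Matrix (Fin n) (Fin n) ℝ, Rᵀ * R = P := ⟨_, hP.sqrt_transpose_mul_sqrt⟩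
  have hdetV : IsUnit V.det := (Matrix.isUnit_iff_isUnit_det _).mp hVu
  rw [IsSchurStable, complexify_sub_mul] at hL
  have hE := norm_mulVec_sq_eq_of_gram hR hC hK
  have hmap : (A - inputMatrix S * K).ofRealMap = _ := complexify_sub_mul A (inputMatrix S) K
  rw [hmap] at hE
  have hstab := Matrix.tendsto_pow_zero_of_spectralRadius_lt_one
    (spectralRadius_closedLoop_lt_one (complexify A) R.ofRealMap (inputMatrix S).ofRealMap
      K.ofRealMap C.ofRealMap L.ofRealMap hL hE)
  have hWA : V⁻¹ * complexify A = diagonal d * V⁻¹ := by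
    calc V⁻¹ * complexify A = V⁻¹ * (complexify A * V) * V⁻¹ := by
          rw [Matrix.mul_assoc, Matrix.mul_assoc, Matrix.mul_nonsing_inv _ hdetV, Matrix.mul_one]
      _ = _ := by rw [hd, ← Matrix.mul_assoc, Matrix.nonsing_inv_mul _ hdetV, Matrix.one_mul]
  -- `condNumber V` is by definition the product of the two operator norms.
  exact energy_bound_of_stabilizing (complexify A) V V⁻¹ (inputMatrix S).ofRealMap K.ofRealMap d
    (Matrix.nonsing_inv_mul _ hdetV) hWA (norm_inputMatrix_le_one S) hstab
    (fun x => ‖WithLp.toLp 2 (R.ofRealMap *ᵥ x)‖ ^ 2) (fun x => by positivity)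
    (lambdaMax P) (norm_mulVec_sq_le_lambdaMax hP hR)
    (fun x => by linarith [hE x, sq_nonneg ‖WithLp.toLp 2 (C.ofRealMap *ᵥ x)‖])
    η hη _ (fun i hi => (Finset.mem_filter.mp hi).2) T (by
      rw [← numEigenvaluesGE_eq_card hVu hd, Fintype.card_coe]
      exact hT)

end

theorem theorem1 (n : ℕ) (A : Matrix (Fin n) (Fin n) ℝ) (hA : IsSchurUnstable A)
    (V : Matrix (Fin n) (Fin n) ℂ) (hV : IsEigenvectorMatrix A V) (S : Finset (Fin n))
    (η : ℝ) (hη1 : 1 < η) (hη2 : ENNReal.ofReal η ≤ spectralRadius ℂ (complexify A))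
    (Q : Matrix (Fin n) (Fin n) ℝ) (hQ : Q.PosSemidef) (hdet : IsDetectable A (CFC.sqrt Q))
    (P : Matrix (Fin n) (Fin n) ℝ) (hP : P.PosSemidef)
    (hric : SolvesRiccati A (inputMatrix S) Q 1 P) :
    lambdaMax P ≥ (condNumber V) ^ (-2 : ℤ) * ((η ^ 2 - 1) / η ^ 2) *
      η ^ (2 * ((numEigenvaluesGE A η : ℝ) / (S.card : ℝ) - 1)) := by
  have hN := numEigenvaluesGE_pos (by linarith) hη2
  set N := numEigenvaluesGE A η
  -- The largest `T` with `T|S| < N`; for empty `S` division by zero gives `0`, which is admissible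
  -- as `N > 0`.
  set T := (N - 1) / S.card with hT
  have key : (η ^ 2 - 1) * η ^ (2 * T) ≤ lambdaMax P * condNumber V ^ 2 := by
    refine le_lambdaMax_mul_condNumber_sq hV hη1 hQ.sqrt_transpose_mul_sqrt hdet hP hric ?_
    have h : T * S.card ≤ N - 1 := Nat.div_mul_le_self (N - 1) S.card
    exact h.trans_lt (Nat.sub_lt hN one_pos)
  have hpos : 0 < η ^ 2 - 1 := by nlinarith
  have hcond : condNumber V ≠ 0 := by
    intro h
    rw [h] at key
    have : 0 < (η ^ 2 - 1) * η ^ (2 * T) := by positivity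
    norm_num at key
    linarith
  have hexp : (N : ℝ) / S.card - 1 ≤ T := by
    rcases Nat.eq_zero_or_pos S.card with hS | hS
    · simp only [hS, Nat.cast_zero, div_zero]
      have : (0 : ℝ) ≤ T := T.cast_nonneg
      linarith
    · have h1 : N ≤ (T + 1) * S.card := by
        have := Nat.lt_div_mul_add (a := N - 1) hS
        rw [← hT] at this
        rw [add_mul]
        omega
      have h2 : (N : ℝ) ≤ (T + 1) * S.card := by exact_mod_cast h1
      rw [sub_le_iff_le_add, div_le_iff₀ (by exact_mod_cast hS)]
      exact h2
  have hpow : η ^ (2 * ((N : ℝ) / S.card - 1)) ≤ η ^ (2 * T) := by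
    rw [← Real.rpow_natCast]
    apply Real.rpow_le_rpow_of_exponent_le hη1.le
    push_cast
    linarith
  have hc2 : 0 < condNumber V ^ 2 := by positivity
  calc condNumber V ^ (-2 : ℤ) * ((η ^ 2 - 1) / η ^ 2) * η ^ (2 * ((N : ℝ) / S.card - 1))
      ≤ (condNumber V ^ 2)⁻¹ * (η ^ 2 - 1) * η ^ (2 * T) := by
        rw [zpow_neg]
        -- A factor `η²` is given away: `key` is stronger than the goal.
        have h1 : (η ^ 2 - 1) / η ^ 2 ≤ η ^ 2 - 1 := div_le_self hpos.le (one_le_pow₀ hη1.le)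
        norm_cast
        gcongr
    _ = ((η ^ 2 - 1) * η ^ (2 * T)) / condNumber V ^ 2 := by ring
    _ ≤ lambdaMax P := (div_le_iff₀ hc2).mpr key
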